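/- Let $X$ be a non-negative stochastic process on $\mathbb{R}^d$ with continuous sample paths (the storm process), with law $\mathbb{P}_X$ on $\mathbb{X}=C(\mathbb{R}^d)$, let $\Psi$ be a non-negative stochastic process on $\mathbb{R}^d$ with continuous sample paths (the intensity process), and let $\mu_Y>0$ be a constant. Let $N=\sum_i\delta_{(s_i,u_i,X_i)}$ be a Cox process on $\mathbb{S}=\mathbb{R}^d\times(0,\infty]\times\mathbb{X}$ directed by the random measure $$\mathrm{d}\Lambda(s,u,x)=\mu_Y^{-1}\,\Psi(s)\,\mathrm{d}s\,u^{-2}\,\mathrm{d}u\,\mathrm{d}\mathbb{P}_X(x),$$ that is, $N$ is a simple point process which, conditionally on $\Lambda$, is a Poisson process with directing measure $\Lambda$. Let $$Y(t)=\bigvee_i u_i\,X_i(t-s_i)\in[0,\infty],\qquad t\in\mathbb{R}^d,$$ be the associated Cox extremal process, where the supremum is over all points of $N$ (and is $0$ if there are none). If $\Psi$ is strictly stationary, i.e. if for all $h,t_1,\dots,t_n\in\mathbb{R}^d$ the vectors $(\Psi(t_1+h),\dots,\Psi(t_n+h))$ and $(\Psi(t_1),\dots,\Psi(t_n))$ have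 the same distribution, then $Y$ is strictly stationary: for all $h,t_1,\dots,t_n\in\mathbb{R}^d$ the vectors $(Y(t_1+h),\dots,Y(t_n+h))$ and $(Y(t_1),\dots,Y(t_n))$ have the same distribution. -/

import Mathlib

open MeasureTheory ProbabilityTheory Set
open scoped ENNReal

namespace CoxExtremal

/-- The index space `ℝ^d` with its Euclidean norm and Lebesgue measure. -/
abbrev Pt (d : ℕ) : Type := EuclideanSpace ℝ (Fin d)

/-- The path space `𝕏 = C(ℝ^d)` with the topology of locally uniform convergence. -/
abbrev PathSpace (d : ℕ) : Type := C(Pt d, ℝ)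

/-- The path space carries its Borel σ-algebra. -/
instance instMeasurableSpacePathSpace (d : ℕ) : MeasurableSpace (PathSpace d) := borel _

instance instBorelSpacePathSpace (d : ℕ) : BorelSpace (PathSpace d) := ⟨rfl⟩

/-- The severities `u ∈ (0, ∞]`. -/
abbrev Severity : Type := Set.Ioi (0 : ℝ≥0∞)

/-- The state space `𝕊 = ℝ^d × (0, ∞] × 𝕏` of the points `(s, u, x)`. -/
abbrev StormSpace (d : ℕ) : Type := Pt d × Severity × PathSpace d

/-- A random field `Z = (Z t)_{t ∈ ℝ^d}` is (strictly) stationary: for all `h` and all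
`t_1, …, t_n`, the vectors `(Z (t_1 + h), …, Z (t_n + h))` and `(Z t_1, …, Z t_n)` have
the same law. -/
def IsStationary {d : ℕ} {Ω β : Type*} [MeasurableSpace Ω] [MeasurableSpace β]
    (P : Measure Ω) (Z : Pt d → Ω → β) : Prop :=
  ∀ (h : Pt d) (n : ℕ) (t : Fin n → Pt d),
    IdentDistrib (fun ω (i : Fin n) => Z (t i + h) ω) (fun ω (i : Fin n) => Z (t i) ω) P P

/-- A simple counting measure: a sum of unit masses at countably many distinct points. -/
def IsSimpleCounting {S : Type*} [MeasurableSpace S] (ν : Measure S) : Prop :=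
  ∃ A : Set S, A.Countable ∧ ν = Measure.sum (fun p : A => Measure.dirac (p : S))

/-- Boundedly finite measures on `𝕊`. Bounded sets of `𝕊` are those with bounded location and
with severity bounded away from `0`; there is no restriction on the path coordinate, because
the usual Fréchet metric of `C(ℝ^d)` is bounded. -/
def IsBoundedlyFinite {d : ℕ} (ν : Measure (StormSpace d)) : Prop :=
  ∀ (R : ℝ) (c : ℝ≥0∞), 0 < c →
    ν {p | p.1 ∈ Metric.closedBall (0 : Pt d) R ∧ c ≤ (p.2.1 : ℝ≥0∞)} < ∞

/-- A point process on `𝕊`: a measurable map into the boundedly finite simple counting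
measures. (`Measure S` carries the σ-algebra generated by the evaluations `ν ↦ ν B`.) -/
structure IsPointProcess {d : ℕ} {Ω : Type*} [MeasurableSpace Ω]
    (N : Ω → Measure (StormSpace d)) : Prop where
  measurable : Measurable N
  simple : ∀ ω, IsSimpleCounting (N ω)
  boundedlyFinite : ∀ ω, IsBoundedlyFinite (N ω)

/-- `Q` is the law `PP(lam)` of a Poisson process with directing measure `lam`: the count of every
measurable `B` with `lam B < ∞` is Poisson with parameter `lam B`, and the counts of disjoint
measurable sets are jointly independent. -/
structure IsPoissonLaw {S : Type*} [MeasurableSpace S]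
    (Q : Measure (Measure S)) (lam : Measure S) : Prop where
  counts : ∀ B : Set S, MeasurableSet B → lam B < ∞ →
    Q.map (fun ν => ν B) =
      (poissonMeasure (lam B).toNNReal).map (fun k : ℕ => (k : ℝ≥0∞))
  indep : ∀ (n : ℕ) (B : Fin n → Set S), (∀ i, MeasurableSet (B i)) →
    Pairwise (fun i j => Disjoint (B i) (B j)) →
      iIndepFun (fun (i : Fin n) (ν : Measure S) => ν (B i)) Q

/-- `N` is a Cox process directed by the random measure `Lam`: it is a point process and,
conditionally on `Lam = lam`, it is a Poisson process with directing measure `lam`; that is, a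
regular conditional distribution `κ` of `N` given `Lam` satisfies `κ lam = PP(lam)` for almost
every value `lam` of `Lam`. -/
structure IsCoxProcess {d : ℕ} {Ω : Type*} [MeasurableSpace Ω] (P : Measure Ω)
    (N Lam : Ω → Measure (StormSpace d)) : Prop where
  pointProcess : IsPointProcess N
  condPoisson : ∃ κ : Kernel (Measure (StormSpace d)) (Measure (StormSpace d)),
    IsMarkovKernel κ ∧ HasCondDistrib N Lam κ P ∧
      ∀ᵐ ω ∂P, IsPoissonLaw (κ (Lam ω)) (Lam ω)

/-- The measure `u⁻² du` on `(0, ∞]` (without mass at `∞`). -/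
noncomputable def severityMeasure : Measure Severity :=
  ((Measure.comap (Subtype.val : Set.Ioi (0 : ℝ) → ℝ) volume).withDensity
      (fun r => ENNReal.ofReal (((r : ℝ) ^ 2)⁻¹))).map
    (fun r : Set.Ioi (0 : ℝ) => (⟨ENNReal.ofReal (r : ℝ), ENNReal.ofReal_pos.2 r.2⟩ : Severity))

/-- The measure `μ⁻¹ ψ(s) ds u⁻² du dPX(x)` on `𝕊`, for a realization `ψ` of the intensity
process, a scaling constant `μ` and the law `PX` of the storm process. -/
noncomputable def directingMeasure {d : ℕ} (μ : ℝ) (ψ : Pt d → ℝ) (PX : Measure (PathSpace d)) :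
    Measure (StormSpace d) :=
  ENNReal.ofReal μ⁻¹ •
    ((volume : Measure (Pt d)).withDensity (fun s => ENNReal.ofReal (ψ s))).prod
      (severityMeasure.prod PX)

/-- The field `Y(t) = ⋁ u_i x_i(t - s_i)`, the supremum over the points `(s_i, u_i, x_i)` of the
counting measure `ν`, with values in `[0, ∞]`. -/
noncomputable def extremalField {d : ℕ} (ν : Measure (StormSpace d)) (t : Pt d) : ℝ≥0∞ :=
  ⨆ p : {p : StormSpace d // ν {p} ≠ 0},
    (p.1.2.1 : ℝ≥0∞) * ENNReal.ofReal (p.1.2.2 (t - p.1.1))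

end CoxExtremal

/-!
By the void probabilities of a Poisson process, `P (Y (t i) ≤ a i for all i) = E exp (-Λ B)`, where
`B` is the set of points `(s, u, x)` with `u x(t i - s) > a i` for some `i`. Shifting the sites
`t i` amounts to translating the locations `s` in `B`, so `Y` is stationary as soon as the law of
`Λ` is invariant under translation of the locations. The measure `Λ` is a measurable function of the
path of `Ψ`, and translating `Λ` is translating this path. Finally, the law of a continuous process
as a random element of the path space is determined by its finite-dimensional distributions, so the
path of a stationary `Ψ` has a translation invariant law.
-/

open Filter TopologicalSpace
open scoped Topology

namespace CoxExtremal

section ContinuousPaths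

variable {X Y Ω : Type*} [TopologicalSpace X] [LocallyCompactSpace X] [SecondCountableTopology X]
  [MetricSpace Y] [CompleteSpace Y] [SecondCountableTopology Y] [MeasurableSpace Y] [BorelSpace Y]
  [MeasurableSpace C(X, Y)] [BorelSpace C(X, Y)] [MeasurableSpace Ω]

lemma measurableEmbedding_eval_dense {D : Set X} [Countable D] (hD : Dense D) :
    MeasurableEmbedding fun (f : C(X, Y)) (x : D) => f x :=
  -- Lusin–Souslin: `C(X, Y)` is Polish, so measurability and injectivity suffice.
  Measurable.measurableEmbedding
    (measurable_pi_lambda _ fun x => (continuous_eval_const (x : X)).measurable)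
    fun f g hfg => DFunLike.coe_injective <|
      f.continuous.ext_on hD g.continuous fun x hx => congrFun hfg ⟨x, hx⟩

lemma measurable_continuousMap_of_eval {Z : Ω → C(X, Y)} (hZ : ∀ x, Measurable fun ω => Z ω x) :
    Measurable Z := by
  obtain ⟨D, hDc, hD⟩ := exists_countable_dense X
  have : Countable D := hDc
  exact (measurableEmbedding_eval_dense hD).measurable_comp_iff.1
    (measurable_pi_lambda _ fun x => hZ x)

lemma identDistrib_continuousMap_of_fin {P : Measure Ω} [IsFiniteMeasure P] {Z W : Ω → C(X, Y)}
    (hZ : Measurable Z) (hW : Measurable W)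
    (h : ∀ (n : ℕ) (t : Fin n → X),
      IdentDistrib (fun ω i => Z ω (t i)) (fun ω i => W ω (t i)) P P) :
    IdentDistrib Z W P P := by
  obtain ⟨D, hDc, hD⟩ := exists_countable_dense X
  have : Countable D := hDc
  have hemb := measurableEmbedding_eval_dense (Y := Y) hD
  have hrestrict :
      IdentDistrib (fun ω (x : D) => Z ω x) (fun ω (x : D) => W ω x) P P := by
    refine (identDistrib_iff_forall_finset_identDistrib
      (X := fun (x : D) ω => Z ω x) (Y := fun (x : D) ω => W ω x)
      (hemb.measurable.comp hZ).aemeasurable (hemb.measurable.comp hW).aemeasurable).2 fun I => ?_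
    have hreindex : Measurable fun (v : Fin I.card → Y) (x : I) => v (I.equivFin x) :=
      measurable_pi_lambda _ fun x => measurable_pi_apply _
    convert! (h I.card fun i => (I.equivFin.symm i : D)).comp hreindex using 1 <;>
      ext ω x <;> simp
  refine ⟨hZ.aemeasurable, hW.aemeasurable, hemb.map_injective ?_⟩
  rw [Measure.map_map hemb.measurable hZ, Measure.map_map hemb.measurable hW]
  exact hrestrict.map_eq

end ContinuousPaths

lemma measure_pi_ext_of_Iic {ι : Type*} [Finite ι] {m m' : Measure (ι → ℝ≥0∞)}
    [IsFiniteMeasure m] (h : ∀ a, m (Iic a) = m' (Iic a)) : m = m' := by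
  refine ext_of_generate_finite (pi univ '' pi univ fun _ : ι => range Iic) ?_
    (IsPiSystem.pi fun _ => isPiSystem_Iic) ?_ ?_
  · refine (generateFrom_eq_pi (fun _ => ?_) fun _ => ?_).symm
    · rw [BorelSpace.measurable_eq (α := ℝ≥0∞), borel_eq_generateFrom_Iic]
    · exact ⟨fun _ => univ, fun _ => ⟨⊤, Iic_top⟩, iUnion_const _⟩
  · rintro _ ⟨C, hC, rfl⟩
    choose a ha using fun i => hC i (mem_univ i)
    rw [← funext ha, pi_univ_Iic, h]
  · simpa using h ⊤

section Poisson

variable {S : Type*} [MeasurableSpace S] {Q : Measure (Measure S)} {lam : Measure S} {B : Set S}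

lemma IsPoissonLaw.measure_void_of_lt_top (hQ : IsPoissonLaw Q lam) (hB : MeasurableSet B)
    (hfin : lam B < ∞) :
    Q {ν | ν B = 0} = ENNReal.ofReal (Real.exp (-(lam B).toReal)) := by
  have hcast : (fun k : ℕ => (k : ℝ≥0∞)) ⁻¹' {0} = {0} := by ext k; simp
  calc Q {ν | ν B = 0} = Q.map (fun ν => ν B) {0} :=
        (Measure.map_apply (Measure.measurable_coe hB) (measurableSet_singleton 0)).symm
    _ = poissonMeasure (lam B).toNNReal {0} := by
        rw [hQ.counts B hB hfin,
          Measure.map_apply (measurable_of_countable _) (measurableSet_singleton 0), hcast]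
    _ = ENNReal.ofReal (Real.exp (-(lam B).toReal)) := by
        simp [poissonMeasure_singleton, ENNReal.coe_toNNReal_eq_toReal]

lemma IsPoissonLaw.measure_void_of_eq_top [SigmaFinite lam] (hQ : IsPoissonLaw Q lam)
    (hB : MeasurableSet B) (htop : lam B = ∞) : Q {ν | ν B = 0} = 0 := by
  have hle (n : ℕ) : Q {ν | ν B = 0} ≤ ENNReal.ofReal (Real.exp (-(n : ℝ))) := by
    obtain ⟨T, hT, hTB, hnT, hTtop⟩ :=
      Measure.exists_subset_measure_lt_top hB (htop ▸ ENNReal.natCast_lt_top n)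
    calc Q {ν | ν B = 0} ≤ Q {ν | ν T = 0} := measure_mono fun ν hν => measure_mono_null hTB hν
      _ = ENNReal.ofReal (Real.exp (-(lam T).toReal)) := hQ.measure_void_of_lt_top hT hTtop
      _ ≤ ENNReal.ofReal (Real.exp (-(n : ℝ))) := by
          gcongr
          simpa using ENNReal.toReal_mono hTtop.ne hnT.le
  have hlim : Tendsto (fun n : ℕ => ENNReal.ofReal (Real.exp (-(n : ℝ)))) atTop (𝓝 0) := by
    simpa using ENNReal.tendsto_ofReal
      (Real.tendsto_exp_neg_atTop_nhds_zero.comp tendsto_natCast_atTop_atTop)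
  exact le_antisymm (ge_of_tendsto' hlim hle) zero_le

lemma IsPoissonLaw.measure_void [SigmaFinite lam] (hQ : IsPoissonLaw Q lam)
    (hB : MeasurableSet B) : Q {ν | ν B = 0} = EReal.exp (-(lam B : EReal)) := by
  by_cases htop : lam B = ∞
  · simp [hQ.measure_void_of_eq_top hB htop, htop]
  · rw [hQ.measure_void_of_lt_top hB (lt_top_iff_ne_top.2 htop), ← EReal.exp_coe, EReal.coe_neg,
      EReal.coe_ennreal_toReal htop]

lemma IsSimpleCounting.measure_eq_zero_iff [MeasurableSingletonClass S] {ν : Measure S}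
    (hν : IsSimpleCounting ν) : ν B = 0 ↔ ∀ p, ν {p} ≠ 0 → p ∉ B := by
  refine ⟨fun h p hp hpB => hp (measure_mono_null (singleton_subset_iff.2 hpB) h), fun h => ?_⟩
  obtain ⟨A, hA, rfl⟩ := hν
  have : Countable A := hA
  have hatom (p : A) : Measure.sum (fun q : A => Measure.dirac (q : S)) {(p : S)} ≠ 0 := by
    intro hzero
    simpa using Measure.sum_apply_eq_zero.1 hzero p
  refine Measure.sum_apply_eq_zero.2 fun p => ?_
  simp [h p (hatom p)]

end Poisson

section ExtremalField

variable {d : ℕ} {ι : Type*} {Ω : Type*} [MeasurableSpace Ω] {P : Measure Ω}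

/-- The storms which, at some site `t i`, exceed the level `a i`. The values of an extremal field at
the sites `t i` are bounded by the levels `a i` iff its point process has no point in this set. -/
def exceedanceSet (t : ι → Pt d) (a : ι → ℝ≥0∞) : Set (StormSpace d) :=
  {p | ∃ i, a i < (p.2.1 : ℝ≥0∞) * ENNReal.ofReal (p.2.2 (t i - p.1))}

lemma measurableSet_exceedanceSet [Countable ι] (t : ι → Pt d) (a : ι → ℝ≥0∞) :
    MeasurableSet (exceedanceSet t a) := by
  have heval : Measurable fun q : PathSpace d × Pt d => q.1 q.2 := continuous_eval.measurable
  simp only [exceedanceSet, ofPred_exists]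
  refine MeasurableSet.iUnion fun i => measurableSet_lt measurable_const ?_
  exact (measurable_subtype_coe.comp measurable_snd.fst).mul
    (heval.comp (measurable_snd.snd.prodMk (measurable_fst.const_sub (t i)))).ennreal_ofReal

/-- The action of `h` on storms by translation of their locations. -/
def translateLocation (h : Pt d) : StormSpace d → StormSpace d :=
  Prod.map (· + h) id

lemma measurable_translateLocation (h : Pt d) : Measurable (translateLocation h) :=
  (measurable_add_const h).prodMap measurable_id

lemma preimage_translateLocation_exceedanceSet (h : Pt d) (t : ι → Pt d) (a : ι → ℝ≥0∞) :
    translateLocation h ⁻¹' exceedanceSet (fun i => t i + h) a = exceedanceSet t a := by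
  ext p
  simp [translateLocation, exceedanceSet]

lemma extremalField_le_iff [Countable ι] {ν : Measure (StormSpace d)} (hν : IsSimpleCounting ν)
    (t : ι → Pt d) (a : ι → ℝ≥0∞) :
    (∀ i, extremalField ν (t i) ≤ a i) ↔ ν (exceedanceSet t a) = 0 := by
  rw [hν.measure_eq_zero_iff]
  simp only [extremalField, iSup_le_iff, Subtype.forall, exceedanceSet, mem_ofPred_eq, not_exists,
    not_lt]
  exact ⟨fun h p hp i => h i p hp, fun h i p hp => h p hp i⟩

lemma IsPointProcess.measurable_extremalField {N : Ω → Measure (StormSpace d)}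
    (hN : IsPointProcess N) (t : Pt d) : Measurable fun ω => extremalField (N ω) t := by
  refine measurable_of_Iic fun a => ?_
  have hvoid : (fun ω => extremalField (N ω) t) ⁻¹' Iic a =
      {ω | N ω (exceedanceSet (fun _ : Unit => t) fun _ => a) = 0} := by
    ext ω
    simpa using extremalField_le_iff (hN.simple ω) (fun _ : Unit => t) (fun _ => a)
  rw [hvoid]
  exact (Measure.measurable_coe (measurableSet_exceedanceSet _ _)).comp hN.measurable
    (measurableSet_singleton 0)

lemma IsCoxProcess.measure_void [IsFiniteMeasure P] {N Lam : Ω → Measure (StormSpace d)}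
    (hN : IsCoxProcess P N Lam) [∀ ω, SigmaFinite (Lam ω)] {B : Set (StormSpace d)}
    (hB : MeasurableSet B) :
    P {ω | N ω B = 0} = ∫⁻ ω, EReal.exp (-(Lam ω B : EReal)) ∂P := by
  obtain ⟨-, κ, hκ, hcond, hpoisson⟩ := hN
  have hvoid : MeasurableSet {ν : Measure (StormSpace d) | ν B = 0} :=
    Measure.measurable_coe hB (measurableSet_singleton 0)
  calc P {ω | N ω B = 0}
      = P.map (fun ω => (Lam ω, N ω)) (univ ×ˢ {ν | ν B = 0}) := by
        rw [Measure.map_apply_of_aemeasurable hcond.aemeasurable (MeasurableSet.univ.prod hvoid),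
          univ_prod]
        rfl
    _ = ∫⁻ lam, κ lam {ν | ν B = 0} ∂(P.map Lam) := by
        rw [hcond.map_eq, Measure.compProd_apply_prod MeasurableSet.univ hvoid,
          Measure.restrict_univ]
    _ = ∫⁻ ω, κ (Lam ω) {ν | ν B = 0} ∂P :=
        lintegral_map' (κ.measurable_coe hvoid).aemeasurable hcond.aemeasurable_fst
    _ = ∫⁻ ω, EReal.exp (-(Lam ω B : EReal)) ∂P :=
        lintegral_congr_ae (hpoisson.mono fun ω hω => hω.measure_void hB)

lemma IsCoxProcess.map_extremalField_Iic [IsFiniteMeasure P] [Countable ι]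
    {N Lam : Ω → Measure (StormSpace d)} (hN : IsCoxProcess P N Lam) [∀ ω, SigmaFinite (Lam ω)]
    (t : ι → Pt d) (a : ι → ℝ≥0∞) :
    P.map (fun ω i => extremalField (N ω) (t i)) (Iic a) =
      ∫⁻ ω, EReal.exp (-(Lam ω (exceedanceSet t a) : EReal)) ∂P := by
  rw [← hN.measure_void (measurableSet_exceedanceSet t a), Measure.map_apply
    (measurable_pi_lambda _ fun i => hN.pointProcess.measurable_extremalField (t i))
    measurableSet_Iic]
  congr 1
  ext ω
  exact extremalField_le_iff (hN.pointProcess.simple ω) t a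

end ExtremalField

section DirectingMeasure

variable {d : ℕ} {Ω : Type*} [MeasurableSpace Ω] {P : Measure Ω}

lemma measurableEmbedding_ofReal_severity :
    MeasurableEmbedding fun r : Set.Ioi (0 : ℝ) =>
      (⟨ENNReal.ofReal (r : ℝ), ENNReal.ofReal_pos.2 r.2⟩ : Severity) := by
  have : StandardBorelSpace (Set.Ioi (0 : ℝ)) := measurableSet_Ioi.standardBorel
  refine Measurable.measurableEmbedding measurable_subtype_coe.ennreal_ofReal.subtype_mk ?_
  intro r r' h
  exact Subtype.ext ((ENNReal.ofReal_eq_ofReal_iff r.2.le r'.2.le).1 (congrArg Subtype.val h))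

instance instSigmaFiniteSeverityMeasure : SigmaFinite severityMeasure := by
  have : SigmaFinite (Measure.comap (Subtype.val : Set.Ioi (0 : ℝ) → ℝ) volume) := by
    refine SigmaFinite.of_map _ measurable_subtype_coe.aemeasurable ?_
    rw [(MeasurableEmbedding.subtype_coe measurableSet_Ioi).map_comap]
    infer_instance
  exact measurableEmbedding_ofReal_severity.sigmaFinite_map

instance instSigmaFiniteDirectingMeasure (μ : ℝ) (ψ : Pt d → ℝ) (PX : Measure (PathSpace d))
    [SigmaFinite PX] : SigmaFinite (directingMeasure μ ψ PX) :=
  SMul.sigmaFinite (Real.toNNReal μ⁻¹)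

lemma directingMeasure_apply (μ : ℝ) {ψ : Pt d → ℝ} (hψ : Measurable ψ)
    (PX : Measure (PathSpace d)) [SFinite PX] {B : Set (StormSpace d)} (hB : MeasurableSet B) :
    directingMeasure μ ψ PX B = ENNReal.ofReal μ⁻¹ *
      ∫⁻ s, ENNReal.ofReal (ψ s) * severityMeasure.prod PX (Prod.mk s ⁻¹' B) := by
  rw [directingMeasure, Measure.smul_apply, Measure.prod_apply hB,
    lintegral_withDensity_eq_lintegral_mul _ hψ.ennreal_ofReal
      (measurable_measure_prodMk_left hB)]
  rfl

lemma measurable_directingMeasure (μ : ℝ) (PX : Measure (PathSpace d)) [SFinite PX] :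
    Measurable fun ψ : PathSpace d => directingMeasure μ ψ PX := by
  refine Measure.measurable_of_measurable_coe _ fun B hB => ?_
  simp_rw [fun ψ : PathSpace d => directingMeasure_apply μ ψ.continuous.measurable PX hB]
  have heval : Measurable fun q : PathSpace d × Pt d => q.1 q.2 := continuous_eval.measurable
  have hsection : Measurable fun q : PathSpace d × Pt d =>
      severityMeasure.prod PX (Prod.mk q.2 ⁻¹' B) :=
    (measurable_measure_prodMk_left hB).comp measurable_snd
  exact (heval.ennreal_ofReal.mul hsection).lintegral_prod_right'.const_mul _

lemma map_translateLocation_directingMeasure (μ : ℝ) {ψ : Pt d → ℝ} (hψ : Measurable ψ)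
    (PX : Measure (PathSpace d)) [SFinite PX] (h : Pt d) :
    (directingMeasure μ ψ PX).map (translateLocation h) =
      directingMeasure μ (fun s => ψ (s - h)) PX := by
  ext B hB
  have hshift := lintegral_add_right_eq_self (μ := (volume : Measure (Pt d)))
    (fun s => ENNReal.ofReal (ψ (s - h)) * severityMeasure.prod PX (Prod.mk s ⁻¹' B)) h
  simp only [add_sub_cancel_right] at hshift
  rw [Measure.map_apply (measurable_translateLocation h) hB,
    directingMeasure_apply μ hψ PX (measurable_translateLocation h hB),
    directingMeasure_apply μ (ψ := fun s => ψ (s - h)) (hψ.comp (measurable_sub_const h)) PX hB,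
    ← hshift]
  rfl

lemma IsStationary.identDistrib_comp_addRight [IsFiniteMeasure P] {Z : Ω → PathSpace d}
    (hZ : Measurable Z) (hstat : IsStationary P fun t ω => Z ω t) (h : Pt d) :
    IdentDistrib (fun ω => (Z ω).comp (ContinuousMap.addRight h)) Z P P :=
  identDistrib_continuousMap_of_fin ((ContinuousMap.continuous_precomp _).measurable.comp hZ) hZ
    (hstat h)

lemma IsStationary.identDistrib_map_translateLocation_directingMeasure [IsFiniteMeasure P]
    {Z : Ω → PathSpace d} (hZ : Measurable Z) (hstat : IsStationary P fun t ω => Z ω t) (μ : ℝ)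
    (PX : Measure (PathSpace d)) [SFinite PX] (h : Pt d) :
    IdentDistrib (fun ω => (directingMeasure μ (Z ω) PX).map (translateLocation h))
      (fun ω => directingMeasure μ (Z ω) PX) P P := by
  simp_rw [fun ω => map_translateLocation_directingMeasure μ (Z ω).continuous.measurable PX h,
    sub_eq_add_neg]
  exact (hstat.identDistrib_comp_addRight hZ (-h)).comp (measurable_directingMeasure μ PX)

end DirectingMeasure

end CoxExtremal

open CoxExtremal

theorem mainTheorem8_general {d : ℕ} {Ω : Type*} [MeasurableSpace Ω] (P : Measure Ω)
    [IsFiniteMeasure P] (N Lam : Ω → Measure (StormSpace d)) [∀ ω, SigmaFinite (Lam ω)]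
    (hN : IsCoxProcess P N Lam)
    (hLam_stat : ∀ h : Pt d, IdentDistrib (fun ω => (Lam ω).map (translateLocation h)) Lam P P) :
    IsStationary P fun t ω => extremalField (N ω) t := by
  intro h n t
  have hmeas (t : Fin n → Pt d) : AEMeasurable (fun ω i => extremalField (N ω) (t i)) P :=
    (measurable_pi_lambda _ fun i => hN.pointProcess.measurable_extremalField (t i)).aemeasurable
  refine ⟨hmeas fun i => t i + h, hmeas t, measure_pi_ext_of_Iic fun a => ?_⟩
  have hB := measurableSet_exceedanceSet (fun i => t i + h) a
  have hvoid : Measurable fun lam : Measure (StormSpace d) =>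
      EReal.exp (-(lam (exceedanceSet (fun i => t i + h) a) : EReal)) :=
    ((Measure.measurable_coe hB).coe_ereal_ennreal.neg).ereal_exp
  calc P.map (fun ω i => extremalField (N ω) (t i + h)) (Iic a)
      = ∫⁻ ω, EReal.exp (-(Lam ω (exceedanceSet (fun i => t i + h) a) : EReal)) ∂P :=
        hN.map_extremalField_Iic (fun i => t i + h) a
    _ = ∫⁻ ω, EReal.exp
          (-((Lam ω).map (translateLocation h) (exceedanceSet (fun i => t i + h) a) : EReal)) ∂P :=
        ((hLam_stat h).comp hvoid).lintegral_eq.symm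
    _ = ∫⁻ ω, EReal.exp (-(Lam ω (exceedanceSet t a) : EReal)) ∂P := by
        simp_rw [Measure.map_apply (measurable_translateLocation h) hB,
          preimage_translateLocation_exceedanceSet]
    _ = P.map (fun ω i => extremalField (N ω) (t i)) (Iic a) :=
        (hN.map_extremalField_Iic t a).symm

theorem mainTheorem8 {d : ℕ}
    -- the storm process: non-negative with continuous sample paths
    {ΩX : Type*} [MeasurableSpace ΩX] (PrX : Measure ΩX) [IsProbabilityMeasure PrX]
    (X : ΩX → CoxExtremal.PathSpace d) (hX : Measurable X) (hX_nonneg : ∀ ω s, 0 ≤ X ω s)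
    -- the intensity process: non-negative with continuous sample paths
    {Ω : Type*} [MeasurableSpace Ω] (P : Measure Ω) [IsProbabilityMeasure P]
    (Ψ : CoxExtremal.Pt d → Ω → ℝ) (hΨ : ∀ s, Measurable (Ψ s))
    (hΨ_cont : ∀ ω, Continuous (fun s => Ψ s ω)) (hΨ_nonneg : ∀ s ω, 0 ≤ Ψ s ω)
    -- the scaling constant
    (μY : ℝ) (hμY : 0 < μY)
    -- the Cox process on the storm space
    (N : Ω → Measure (CoxExtremal.StormSpace d))
    (hN : CoxExtremal.IsCoxProcess P N
      (fun ω => CoxExtremal.directingMeasure μY (fun s => Ψ s ω) (PrX.map X)))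
    -- stationarity of the intensity process
    (hΨ_stat : CoxExtremal.IsStationary P Ψ) :
    CoxExtremal.IsStationary P
      (fun (t : CoxExtremal.Pt d) (ω : Ω) => CoxExtremal.extremalField (N ω) t) := by
  have := Measure.isProbabilityMeasure_map (μ := PrX) hX.aemeasurable
  let Z (ω : Ω) : PathSpace d := ⟨fun s => Ψ s ω, hΨ_cont ω⟩
  exact mainTheorem8_general P N _ hN (hΨ_stat.identDistrib_map_translateLocation_directingMeasure
    (Z := Z) (measurable_continuousMap_of_eval hΨ) μY (PrX.map X))
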